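/- Let $H\in(1/2,1)$ and let $h:[-1/2,1/2]\to\mathbb R$ be even, positive and continuous, and three times continuously differentiable on $(-1/2,1/2)$. For $x\in[-1/2,1/2]$, $x\neq 0$, let $$f_H(x)=h(x)\,|2\sin \pi x|^{-(2H-1)}$$ be the spectral density of the fractionally differenced process $(1-B)^{-(H-1/2)}Y$ whose driving process $Y$ is real-valued and second-order stationary with spectral density $h$ ($B$ is the backshift operator), and let $$f_H^*(x)=c_f^*\,\pi^{-2}(2\pi)^{2H+1}\sin^2(\pi x)\sum_{j=-\infty}^{\infty}|2\pi j+2\pi x|^{-(2H+1)},\qquad c_f^*=V(2\pi)^{2-2H}\,\pi^{-1}H\,\Gamma(2H)\sin(H\pi),$$ be the spectral density of fractional Gaussian noise with Hurst parameter $H$ and variance $V>0$. Suppose that $V$ is chosen such that both densities have the same power-law prefactor at the origin, i.e. $c_f^*=c_f:=(2\pi)^{1-2H}h(0)$. Then there is a function $\varphi$ with $f_H(x)=f_H^*(x)+\varphi(x)$ for all $x\in[-1/2,1/2]$, $x\ne0$, such that $\varphi(0)=0$, $\varphi(x)=O(|x|^{3-2H})$ as $x\to0$, and $\varphi$ is differentiable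 on $(-1/2,1/2)$ (in particular, $\varphi$ is the continuous extension of $f_H-f_H^*$ to the origin). For every $0\le\alpha<2-2H$ and $0<r<1/2$, the derivative $\varphi'$ is uniformly $\alpha$-Hölder continuous on $[-r,r]$, i.e. $\sup_{x\neq y}|\varphi'(x)-\varphi'(y)|\,|x-y|^{-\alpha}<\infty$ over $x,y\in[-r,r]$. If moreover $h$ is three times continuously differentiable up to the endpoints, i.e. on the closed interval $[-1/2,1/2]$, then $\varphi$ is differentiable on $[-1/2,1/2]$ (one-sidedly at the endpoints) and, for every $0\le\alpha<2-2H$, $\varphi'$ is uniformly $\alpha$-Hölder continuous on all of $[-1/2,1/2]$. -/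

import Mathlib

open Set Filter Topology Asymptotics
open scoped NNReal

noncomputable section

namespace FracNoise

/-- Spectral density, at normalised frequency `x ∈ [-1/2, 1/2]`, `x ≠ 0`, of the process
`(1 - B)^{-(H - 1/2)} Y`, where `h` is the spectral density of the driving process `Y`:
`f_H(x) = h(x) |2 sin πx|^{-(2H-1)}`. -/
def fracDensity (H : ℝ) (h : ℝ → ℝ) (x : ℝ) : ℝ :=
  h x * |2 * Real.sin (Real.pi * x)| ^ (-(2 * H - 1))

/-- Prefactor `c_f = (2π)^{1-2H} h(0)` of the power law of `f_H` at the origin. -/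
def fracPrefactor (H : ℝ) (h : ℝ → ℝ) : ℝ :=
  (2 * Real.pi) ^ (1 - 2 * H) * h 0

/-- The constant `C(H) = π⁻¹ H Γ(2H) sin(Hπ)`. -/
def fgnConst (H : ℝ) : ℝ :=
  Real.pi⁻¹ * H * Real.Gamma (2 * H) * Real.sin (H * Real.pi)

/-- Prefactor `c_f^* = V (2π)^{2-2H} C(H)` of the power law at the origin of the spectral density
of fractional Gaussian noise with Hurst parameter `H` and variance `V`. -/
def fgnPrefactor (H V : ℝ) : ℝ :=
  V * (2 * Real.pi) ^ (2 - 2 * H) * fgnConst H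

/-- Spectral density, at normalised frequency `x ∈ [-1/2, 1/2]`, `x ≠ 0`, of fractional Gaussian
noise with Hurst parameter `H` and variance `V`:
`f_H^*(x) = c_f^* π⁻² (2π)^{2H+1} sin²(πx) ∑_{j ∈ ℤ} |2πj + 2πx|^{-(2H+1)}`. -/
def fgnDensity (H V x : ℝ) : ℝ :=
  fgnPrefactor H V * (Real.pi ^ 2)⁻¹ * (2 * Real.pi) ^ (2 * H + 1) *
    Real.sin (Real.pi * x) ^ 2 *
    ∑' j : ℤ, |2 * Real.pi * (j : ℝ) + 2 * Real.pi * x| ^ (-(2 * H + 1))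

end FracNoise

end

/-! Put s = 2H - 1 ∈ (0, 1). Since sin πx = πx · sinc(πx), both f_H and the j = 0 term of f_H^* are
|x|^{-s} times a regular factor. The terms j ≠ 0 contribute a function R (`aliasedPart`) that is C²
up to the endpoints. Hence φ = |x|^{-s} g - R with g = `regularFactor`. Equal prefactors give g(0) =
0 and evenness gives g'(0) = 0; likewise R(0) = R'(0) = 0. So g and R are O(x²), and φ =
O(|x|^{2-s}) with 2 - s = 3 - 2H.

Differentiating, φ' = |x|^{-s} (g' - s g/x) - R'. Since g' is Lipschitz, so is g/x, the average of
g' over the segment from 0 to x (`abs_div_sub_div_le`). The bracket is thus Lipschitz and vanishes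
at 0, and multiplication by |x|^{-s} leaves it Hölder of exponent 1 - s = 2 - 2H
(`abs_rpow_neg_mul_sub_le`). -/

namespace FracNoise

/-! ### Hölder and derivative estimates for |x|^{-s} times a regular function -/

/-- If `m` is Lipschitz on `S ∋ 0` and vanishes at `0`, then `|x|^{-s} m(x)` is
`(1 - s)`-Hölder on `S`. -/
theorem abs_rpow_neg_mul_sub_le {s L : ℝ} (hs0 : 0 < s) (hs1 : s < 1) (hL : 0 ≤ L)
    {m : ℝ → ℝ} {S : Set ℝ} (h0 : (0 : ℝ) ∈ S) (hm0 : m 0 = 0)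
    (hm : ∀ x ∈ S, ∀ y ∈ S, |m x - m y| ≤ L * |x - y|) :
    ∀ x ∈ S, ∀ y ∈ S,
      |(|x| ^ (-s) * m x - |y| ^ (-s) * m y)| ≤ 4 * L * |x - y| ^ (1 - s) := by
  have key : ∀ x ∈ S, ∀ y ∈ S, |y| ≤ |x| →
      |(|x| ^ (-s) * m x - |y| ^ (-s) * m y)| ≤ 4 * L * |x - y| ^ (1 - s) := by
    intro x hx y hy hyx
    rcases eq_or_ne x y with rfl | hxy
    · simp only [sub_self, abs_zero]; positivity
    have hδ : 0 < |x - y| := abs_pos.2 (sub_ne_zero.2 hxy)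
    have ha : 0 < |x| := by
      rcases (abs_nonneg x).lt_or_eq with h | h
      · exact h
      · have h1 : |y| = 0 := le_antisymm (h ▸ hyx) (abs_nonneg y)
        exact absurd ((abs_eq_zero.1 h.symm).trans (abs_eq_zero.1 h1).symm) hxy
    have hδ2 : |x - y| ≤ 2 * |x| := by
      linarith [abs_sub x y]
    have hxyδ : |x| - |y| ≤ |x - y| := abs_sub_abs_le_abs_sub x y
    have hpa : 0 < |x| ^ (-s) := Real.rpow_pos_of_pos ha _
    have h1 : |x| ^ (-s) * (|x| - |y|) ≤ |x| ^ (-s) * |x - y| := by gcongr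
    have e1 : |x - y| ^ (1 - s) = |x - y| * |x - y| ^ (-s) := by
      rw [← Real.rpow_one_add' hδ.le (by linarith)]
      rfl
    -- As |x| is the larger modulus, |x| ≥ |x - y| / 2, so |x|^{-s} ≤ 2^s |x - y|^{-s} with 2^s ≤ 2.
    have h2 : |x| ^ (-s) * |x - y| ≤ 2 * |x - y| ^ (1 - s) := by
      have h3 : |x| ^ (-s) ≤ (|x - y| / 2) ^ (-s) :=
        Real.rpow_le_rpow_of_nonpos (by positivity) (by linarith) (by linarith)
      rw [Real.div_rpow hδ.le (by norm_num), Real.rpow_neg (by norm_num : (0 : ℝ) ≤ 2),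
        div_inv_eq_mul] at h3
      have h4 : (2 : ℝ) ^ s ≤ 2 := by
        simpa using Real.rpow_le_rpow_of_exponent_le (by norm_num : (1 : ℝ) ≤ 2) hs1.le
      rw [e1]
      calc |x| ^ (-s) * |x - y| ≤ (|x - y| ^ (-s) * 2) * |x - y| := by
            gcongr
            exact h3.trans (by gcongr)
        _ = _ := by ring
    -- The bound |m y| ≤ L|y| absorbs the singularity at y: monotonicity of t^{1-s} gives |y|
    -- (|y|^{-s} - |x|^{-s}) ≤ |x|^{-s} (|x| - |y|).
    have h3 : |m y| * |(|x| ^ (-s) - |y| ^ (-s))| ≤ L * (|x| ^ (-s) * |x - y|) := by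
      rcases (abs_nonneg y).eq_or_lt with h | hb
      · rw [abs_eq_zero.1 h.symm, hm0, abs_zero, zero_mul]
        positivity
      have hmy : |m y| ≤ L * |y| := by simpa [hm0] using hm y hy 0 h0
      have h4 : |x| ^ (-s) ≤ |y| ^ (-s) := Real.rpow_le_rpow_of_nonpos hb hyx (by linarith)
      have h5 : |y| * |y| ^ (-s) ≤ |x| * |x| ^ (-s) := by
        rw [← Real.rpow_one_add' hb.le (by linarith), ← Real.rpow_one_add' ha.le (by linarith)]
        exact Real.rpow_le_rpow hb.le hyx (by linarith)
      rw [abs_sub_comm, abs_of_nonneg (sub_nonneg.2 h4)]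
      calc |m y| * (|y| ^ (-s) - |x| ^ (-s)) ≤ L * |y| * (|y| ^ (-s) - |x| ^ (-s)) :=
            mul_le_mul_of_nonneg_right hmy (sub_nonneg.2 h4)
        _ = L * (|y| * |y| ^ (-s) - |y| * |x| ^ (-s)) := by ring
        _ ≤ L * (|x| ^ (-s) * |x - y|) := by
            refine mul_le_mul_of_nonneg_left ?_ hL
            linarith
    calc |(|x| ^ (-s) * m x - |y| ^ (-s) * m y)|
        = |(|x| ^ (-s) * (m x - m y) + m y * (|x| ^ (-s) - |y| ^ (-s)))| := by ring_nf
      _ ≤ |x| ^ (-s) * |m x - m y| + |m y| * |(|x| ^ (-s) - |y| ^ (-s))| := by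
          refine (abs_add_le _ _).trans_eq ?_
          rw [abs_mul, abs_mul, abs_of_pos hpa]
      _ ≤ |x| ^ (-s) * (L * |x - y|) + L * (|x| ^ (-s) * |x - y|) := by
          gcongr
          exact hm x hx y hy
      _ = 2 * L * (|x| ^ (-s) * |x - y|) := by ring
      _ ≤ 2 * L * (2 * |x - y| ^ (1 - s)) := by gcongr
      _ = 4 * L * |x - y| ^ (1 - s) := by ring
  intro x hx y hy
  rcases le_total |y| |x| with h | h
  · exact key x hx y hy h
  · rw [abs_sub_comm, abs_sub_comm x]
    exact key y hy x hx h

/-- Mean value inequality for the difference quotient `g(x) / x`. -/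
theorem abs_div_sub_div_le {r L : ℝ} {g g' : ℝ → ℝ}
    (hg : ∀ x ∈ Icc (-r) r, HasDerivWithinAt g (g' x) (Icc (-r) r) x)
    (hg0 : g 0 = 0) (hg'0 : g' 0 = 0) (hL : 0 ≤ L)
    (hg' : ∀ x ∈ Icc (-r) r, ∀ y ∈ Icc (-r) r, |g' x - g' y| ≤ L * |x - y|) :
    ∀ x ∈ Icc (-r) r, ∀ y ∈ Icc (-r) r, |g x / x - g y / y| ≤ L * |x - y| := by
  have hmem : ∀ x ∈ Icc (-r) r, ∀ t ∈ Icc (0 : ℝ) 1, t * x ∈ Icc (-r) r := by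
    intro x hx t ht
    rw [mem_Icc, ← abs_le, abs_mul, abs_of_nonneg ht.1]
    have := abs_le.2 hx
    nlinarith [ht.2, abs_nonneg x]
  -- The path t ↦ g(tx)/x runs from 0 to g(x)/x with velocity g'(tx). At x = 0 it is constantly 0,
  -- because g 0 / 0 = 0, which agrees with g' 0 = 0.
  have hder : ∀ x ∈ Icc (-r) r, ∀ t ∈ Icc (0 : ℝ) 1,
      HasDerivWithinAt (fun t => g (t * x) / x) (g' (t * x)) (Icc 0 1) t := by
    intro x hx t ht
    rcases eq_or_ne x 0 with rfl | hx0
    · simpa [hg'0] using hasDerivWithinAt_const t (Icc (0 : ℝ) 1) (0 : ℝ)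
    have h1 : HasDerivWithinAt (fun t => t * x) (1 * x) (Icc (0 : ℝ) 1) t :=
      (hasDerivWithinAt_id t _).mul_const x
    have h2 := ((hg _ (hmem x hx t ht)).comp t h1 (fun u hu => hmem x hx u hu)).div_const x
    refine h2.congr_deriv ?_
    field_simp
  intro x hx y hy
  have := norm_image_sub_le_of_norm_deriv_le_segment_01' (C := L * |x - y|)
    (fun t ht => (hder x hx t ht).sub (hder y hy t ht)) (fun t ht => by
      have ht' : t ∈ Icc (0 : ℝ) 1 := Ico_subset_Icc_self ht
      rw [Real.norm_eq_abs]
      refine (hg' _ (hmem x hx t ht') _ (hmem y hy t ht')).trans ?_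
      rw [← mul_sub, abs_mul, abs_of_nonneg ht.1]
      have := mul_le_of_le_one_left (abs_nonneg (x - y)) ht.2.le
      gcongr)
  simpa [hg0] using this

theorem abs_le_mul_sq {r L : ℝ} (hr : 0 < r) {g g' : ℝ → ℝ}
    (hg : ∀ x ∈ Icc (-r) r, HasDerivWithinAt g (g' x) (Icc (-r) r) x)
    (hg0 : g 0 = 0) (hg'0 : g' 0 = 0) (hL : 0 ≤ L)
    (hg' : ∀ x ∈ Icc (-r) r, ∀ y ∈ Icc (-r) r, |g' x - g' y| ≤ L * |x - y|) :
    ∀ x ∈ Icc (-r) r, |g x| ≤ L * |x| ^ 2 := by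
  intro x hx
  have h := abs_div_sub_div_le hg hg0 hg'0 hL hg' x hx 0 ⟨by linarith, hr.le⟩
  rcases eq_or_ne x 0 with rfl | hx0
  · simp [hg0]
  · simp only [div_zero, sub_zero, abs_div] at h
    rw [div_le_iff₀ (abs_pos.2 hx0)] at h
    linarith

theorem abs_rpow_neg_mul_le {s L r : ℝ} (hs1 : s < 1) {g : ℝ → ℝ}
    (hq : ∀ x ∈ Icc (-r) r, |g x| ≤ L * |x| ^ 2) :
    ∀ x ∈ Icc (-r) r, |(|x| ^ (-s) * g x)| ≤ L * |x| ^ (2 - s) := by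
  intro x hx
  have e : |x| ^ (2 - s) = |x| ^ (-s) * |x| ^ 2 := by
    rcases eq_or_ne x 0 with rfl | hx0
    · rw [abs_zero, Real.zero_rpow (by linarith)]; simp
    · rw [← Real.rpow_natCast, ← Real.rpow_add (abs_pos.2 hx0)]
      congr 1; push_cast; ring
  rw [abs_mul, abs_of_nonneg (Real.rpow_nonneg (abs_nonneg x) _), e]
  calc _ ≤ |x| ^ (-s) * (L * |x| ^ 2) := by gcongr; exact hq x hx
    _ = _ := by ring

/-- Away from 0 this is the product rule, with |x|^{-s} factored out. At 0 the formula evaluates to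
0, and the product is O(|x|^{2-s}) = o(x) because s < 1. -/
theorem hasDerivWithinAt_abs_rpow_neg_mul {s L r : ℝ} (hs1 : s < 1)
    {g g' : ℝ → ℝ}
    (hg : ∀ x ∈ Icc (-r) r, HasDerivWithinAt g (g' x) (Icc (-r) r) x)
    (hg0 : g 0 = 0) (hg'0 : g' 0 = 0)
    (hq : ∀ x ∈ Icc (-r) r, |g x| ≤ L * |x| ^ 2) :
    ∀ x ∈ Icc (-r) r, HasDerivWithinAt (fun x => |x| ^ (-s) * g x)
      (|x| ^ (-s) * (g' x - s * (g x / x))) (Icc (-r) r) x := by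
  intro x hx
  rcases eq_or_ne x 0 with rfl | hx0
  · simp only [hg'0, div_zero, mul_zero, sub_zero]
    rw [hasDerivWithinAt_iff_isLittleO]
    simp only [hg0, mul_zero, sub_zero, smul_zero]
    have h1 : (fun x => |x| ^ (-s) * g x) =O[𝓝[Icc (-r) r] 0] fun x => |x| ^ (2 - s) := by
      refine IsBigO.of_bound L ?_
      filter_upwards [self_mem_nhdsWithin] with x hx
      rw [Real.norm_eq_abs, Real.norm_eq_abs, abs_of_nonneg (Real.rpow_nonneg (abs_nonneg x) _)]
      exact abs_rpow_neg_mul_le hs1 hq x hx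
    refine h1.trans_isLittleO ?_
    have h2 : Tendsto (fun x : ℝ => |x| ^ (1 - s)) (𝓝[Icc (-r) r] 0) (𝓝 0) := by
      have : ContinuousAt (fun x : ℝ => |x| ^ (1 - s)) 0 :=
        continuous_abs.continuousAt.rpow_const (Or.inr (by linarith))
      have h3 := this.tendsto
      rw [abs_zero, Real.zero_rpow (by linarith)] at h3
      exact h3.mono_left nhdsWithin_le_nhds
    have h3 : (fun x : ℝ => |x| ^ (1 - s) * |x|) =o[𝓝[Icc (-r) r] 0] fun x => x := by
      have := ((isLittleO_one_iff ℝ).2 h2).mul_isBigO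
        ((isBigO_refl (fun x : ℝ => x) (𝓝[Icc (-r) r] 0)).abs_left)
      simpa using this
    refine h3.congr_left fun x => ?_
    rcases eq_or_ne x 0 with rfl | hx0
    · rw [abs_zero, Real.zero_rpow (by linarith : 2 - s ≠ 0)]; simp
    · rw [← Real.rpow_add_one (abs_pos.2 hx0).ne']
      congr 1; ring
  · have ha := abs_pos.2 hx0
    have h1 : HasDerivAt (fun x : ℝ => |x| ^ (-s)) (-(s * |x| ^ (-s) / x)) x := by
      refine ((hasDerivAt_abs hx0).rpow_const (p := -s) (Or.inl ha.ne')).congr_deriv ?_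
      rw [Real.rpow_sub_one ha.ne']
      rcases hx0.lt_or_gt with h | h
      · simp [h, abs_of_neg h]; field_simp
      · simp [h, abs_of_pos h]; field_simp
    refine (h1.hasDerivWithinAt.mul (hg x hx)).congr_deriv ?_
    ring

theorem exists_lipschitz_derivWithin {r : ℝ} (hr : 0 < r) {g : ℝ → ℝ}
    (hg : ContDiffOn ℝ 2 g (Icc (-r) r)) :
    (∀ x ∈ Icc (-r) r, HasDerivWithinAt g (derivWithin g (Icc (-r) r) x) (Icc (-r) r) x) ∧
    ∃ L : ℝ, 0 ≤ L ∧ ∀ x ∈ Icc (-r) r, ∀ y ∈ Icc (-r) r,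
      |derivWithin g (Icc (-r) r) x - derivWithin g (Icc (-r) r) y| ≤ L * |x - y| := by
  have hu : UniqueDiffOn ℝ (Icc (-r) r) := uniqueDiffOn_Icc (by linarith)
  refine ⟨fun x hx => ((hg.differentiableOn (by norm_num)) x hx).hasDerivWithinAt, ?_⟩
  have h1 : ContDiffOn ℝ 1 (derivWithin g (Icc (-r) r)) (Icc (-r) r) :=
    hg.derivWithin hu (by norm_num)
  obtain ⟨K, hK⟩ := (h1.locallyLipschitzOn (convex_Icc _ _)).exists_lipschitzOnWith_of_compact
    isCompact_Icc
  refine ⟨K, K.2, fun x hx y hy => ?_⟩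
  have := hK.dist_le_mul x hx y hy
  rwa [Real.dist_eq, Real.dist_eq] at this

/-- When distances are at most 1, lowering the exponent only enlarges the right-hand side, so the
estimate at the critical exponent serves every smaller α. -/
theorem holderOnWith_of_abs_sub_le {C β : ℝ} {α : ℝ≥0} (hC : 0 ≤ C) {d : ℝ → ℝ} {S : Set ℝ}
    (hS : ∀ x ∈ S, ∀ y ∈ S, |x - y| ≤ 1) (hαβ : (α : ℝ) ≤ β)
    (hd : ∀ x ∈ S, ∀ y ∈ S, |d x - d y| ≤ C * |x - y| ^ β) :
    HolderOnWith C.toNNReal α d S := by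
  intro x hx y hy
  have h1 : |d x - d y| ≤ C * |x - y| ^ (α : ℝ) :=
    (hd x hx y hy).trans (mul_le_mul_of_nonneg_left
      (Real.rpow_le_rpow_of_exponent_ge' (abs_nonneg _) (hS x hx y hy) α.coe_nonneg hαβ) hC)
  rw [edist_dist, edist_dist, ENNReal.ofReal_rpow_of_nonneg dist_nonneg α.coe_nonneg]
  change _ ≤ ENNReal.ofReal C * _
  rw [← ENNReal.ofReal_mul hC]
  exact ENNReal.ofReal_le_ofReal h1

/-! ### Smoothness and positivity of sinc -/

theorem contDiff_sinc {n : WithTop ℕ∞} : ContDiff ℝ n Real.sinc := by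
  have : AnalyticOnNhd ℝ Real.sinc univ := by
    rw [Real.sinc_eq_dslope]
    intro x _
    rcases eq_or_ne x 0 with rfl | hx
    · obtain ⟨p, hp⟩ := Real.analyticAt_sin (x := (0 : ℝ))
      exact ⟨_, hp.has_fpower_series_dslope_fslope⟩
    · have h1 : AnalyticAt ℝ (fun y : ℝ => Real.sin y / y) x :=
        Real.analyticAt_sin.div analyticAt_id hx
      refine h1.congr ?_
      filter_upwards [isOpen_ne.mem_nhds hx] with y hy
      rw [← Real.sinc_eq_dslope, Real.sinc_of_ne_zero hy]
  exact this.contDiff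

theorem sinc_pi_mul_pos {x : ℝ} (hx : x ∈ Icc (-1 / 2 : ℝ) (1 / 2)) :
    0 < Real.sinc (Real.pi * x) := by
  have key : ∀ y : ℝ, 0 ≤ y → y ≤ 1 / 2 → 0 < Real.sinc (Real.pi * y) := by
    intro y hy0 hy1
    rcases hy0.eq_or_lt with rfl | hy
    · simp
    have hpy : 0 < Real.pi * y := by positivity
    rw [Real.sinc_of_ne_zero hpy.ne']
    exact div_pos (Real.sin_pos_of_pos_of_lt_pi hpy (by nlinarith [Real.pi_pos])) hpy
  rcases le_total 0 x with h | h
  · exact key x h hx.2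
  · have := key (-x) (by linarith) (by linarith [hx.1])
    rwa [mul_neg, Real.sinc_neg] at this

/-! ### The lattice sum without its central term -/

/-- The one-sided sum `∑_{n ≥ 1} (n + x)^{-p}`. -/
noncomputable def shiftedSum (p x : ℝ) : ℝ := ∑' n : ℕ, ((n : ℝ) + 1 + x) ^ (-p)

theorem summable_add_quarter_rpow {p : ℝ} (hp : 1 < p) :
    Summable fun n : ℕ => ((n : ℝ) + 1 / 4) ^ (-p) := by
  have := (Real.summable_one_div_nat_add_rpow (1 / 4) p).2 hp
  refine this.congr fun n => ?_
  rw [abs_of_pos (by positivity), Real.rpow_neg (by positivity), one_div]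

theorem summable_shiftedSum {p x : ℝ} (hp : 1 < p) (hx : -3 / 4 < x) :
    Summable fun n : ℕ => ((n : ℝ) + 1 + x) ^ (-p) := by
  refine Summable.of_nonneg_of_le (fun n => Real.rpow_nonneg ?_ _) (fun n => ?_)
    (summable_add_quarter_rpow hp)
  · have : (0 : ℝ) ≤ n := n.cast_nonneg
    linarith
  · exact Real.rpow_le_rpow_of_nonpos (by positivity) (by linarith) (by linarith)

/-- On the half-plane Re z > -3/4 the complexified series is dominated by ∑ (k + 1/4)^{-p}, hence
holomorphic; its restriction to the real axis is smooth. The half-plane contains [-1/2, 1/2] in its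
interior, so regularity reaches the endpoints. -/
theorem contDiffAt_shiftedSum {n : WithTop ℕ∞} {p x : ℝ} (hp : 1 < p) (hx : -3 / 4 < x) :
    ContDiffAt ℝ n (shiftedSum p) x := by
  let U : Set ℂ := {z | -3 / 4 < z.re}
  have hU : IsOpen U := isOpen_lt continuous_const Complex.continuous_re
  have hre : ∀ (k : ℕ) (z : ℂ), z ∈ U → (k : ℝ) + 1 / 4 < ((k : ℂ) + 1 + z).re := by
    intro k z hz
    have hz' : -3 / 4 < z.re := hz
    simp only [Complex.add_re, Complex.natCast_re, Complex.one_re]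
    linarith
  have hd : DifferentiableOn ℂ (fun z : ℂ => ∑' k : ℕ, ((k : ℂ) + 1 + z) ^ ((-p : ℝ) : ℂ)) U := by
    refine Complex.differentiableOn_tsum_of_summable_norm (summable_add_quarter_rpow hp) ?_ hU ?_
    · intro k z hz
      refine DifferentiableAt.differentiableWithinAt ?_
      refine DifferentiableAt.cpow_const (by fun_prop) ?_
      left
      have := hre k z hz
      have h0 : (0 : ℝ) ≤ k := k.cast_nonneg
      linarith
    · intro k z hz
      rw [Complex.norm_cpow_real]
      refine Real.rpow_le_rpow_of_nonpos (by positivity) ?_ (by linarith)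
      exact (hre k z hz).le.trans (Complex.re_le_norm _)
  have hxU : (x : ℂ) ∈ U := hx
  have h1 := ((hd.analyticOnNhd hU (x : ℂ) hxU).contDiffAt (n := n)).real_of_complex
  refine h1.congr_of_eventuallyEq ?_
  filter_upwards [lt_mem_nhds hx] with y hy
  have e : ∀ k : ℕ, ((k : ℂ) + 1 + y) ^ ((-p : ℝ) : ℂ) = ((((k : ℝ) + 1 + y) ^ (-p) : ℝ) : ℂ) := by
    intro k
    have h0 : (0 : ℝ) ≤ k := k.cast_nonneg
    rw [Complex.ofReal_cpow (by linarith)]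
    push_cast
    rfl
  simp_rw [e]
  rw [← Complex.ofReal_tsum, Complex.ofReal_re, shiftedSum]

/-- Isolates j = 0, the only term singular on [-1/2, 1/2]; positive and negative j give the two
one-sided sums. -/
theorem tsum_int_abs_rpow {p x : ℝ} (hp : 1 < p) (hx : x ∈ Icc (-1 / 2 : ℝ) (1 / 2)) :
    ∑' j : ℤ, |2 * Real.pi * (j : ℝ) + 2 * Real.pi * x| ^ (-p) =
      (2 * Real.pi) ^ (-p) * (|x| ^ (-p) + (shiftedSum p x + shiftedSum p (-x))) := by
  have hpi : 0 < 2 * Real.pi := by positivity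
  have e : ∀ j : ℤ, |2 * Real.pi * (j : ℝ) + 2 * Real.pi * x| ^ (-p) =
      (2 * Real.pi) ^ (-p) * |(j : ℝ) + x| ^ (-p) := by
    intro j
    rw [← mul_add, abs_mul, abs_of_pos hpi, Real.mul_rpow hpi.le (abs_nonneg _)]
  simp_rw [e]
  rw [tsum_mul_left]
  congr 1
  have h1 : HasSum (fun n : ℕ => |(((n : ℤ) + 1 : ℤ) : ℝ) + x| ^ (-p)) (shiftedSum p x) := by
    rw [shiftedSum]
    convert (summable_shiftedSum hp (x := x) (by linarith [hx.1])).hasSum using 3 with n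
    push_cast
    exact abs_of_pos (by linarith [hx.1, (n.cast_nonneg : (0 : ℝ) ≤ n)])
  have h2 : HasSum (fun n : ℕ => |((-((n : ℤ) + 1) : ℤ) : ℝ) + x| ^ (-p)) (shiftedSum p (-x)) := by
    rw [shiftedSum]
    convert (summable_shiftedSum hp (x := -x) (by linarith [hx.2])).hasSum using 3 with n
    push_cast
    rw [abs_of_neg (by linarith [hx.2, (n.cast_nonneg : (0 : ℝ) ≤ n)])]
    ring
  have := (HasSum.of_add_one_of_neg_add_one (f := fun j : ℤ => |(j : ℝ) + x| ^ (-p)) h1 h2).tsum_eq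
  rw [this]
  simp
  ring

/-! ### Decomposition of the difference of the densities -/

/-- The factor `g` in `f_H(x) - c_f (sin πx / πx)² |x|^{-(2H-1)} = |x|^{-(2H-1)} g(x)`. -/
noncomputable def regularFactor (H : ℝ) (h : ℝ → ℝ) (x : ℝ) : ℝ :=
  (2 * Real.pi) ^ (1 - 2 * H) *
    (h x * Real.sinc (Real.pi * x) ^ (-(2 * H - 1)) - h 0 * Real.sinc (Real.pi * x) ^ 2)

/-- The part of the spectral density of fractional Gaussian noise, with prefactor `c`,
that comes from the nonzero frequency shifts. -/
noncomputable def aliasedPart (H c x : ℝ) : ℝ :=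
  c * (Real.pi ^ 2)⁻¹ * Real.sin (Real.pi * x) ^ 2 *
    (shiftedSum (2 * H + 1) x + shiftedSum (2 * H + 1) (-x))

/-- The continuous extension of `f_H - f_H^*` to the origin. -/
noncomputable def densityDiff (H c : ℝ) (h : ℝ → ℝ) (x : ℝ) : ℝ :=
  |x| ^ (-(2 * H - 1)) * regularFactor H h x - aliasedPart H c x

theorem fracDensity_eq {H V : ℝ} {h : ℝ → ℝ} (hH : 1 / 2 < H)
    (hnorm : fracPrefactor H h = fgnPrefactor H V)
    {x : ℝ} (hx : x ∈ Icc (-1 / 2 : ℝ) (1 / 2)) (hx0 : x ≠ 0) :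
    fracDensity H h x = fgnDensity H V x + densityDiff H (fgnPrefactor H V) h x := by
  have hpi : 0 < 2 * Real.pi := by positivity
  have hax : 0 < |x| := abs_pos.2 hx0
  have hS := sinc_pi_mul_pos hx
  have hpx : Real.pi * x ≠ 0 := mul_ne_zero Real.pi_ne_zero hx0
  have hsin : Real.sin (Real.pi * x) = Real.pi * x * Real.sinc (Real.pi * x) := by
    rw [Real.sinc_of_ne_zero hpx]
    field_simp
  have e1 : |2 * Real.sin (Real.pi * x)| ^ (-(2 * H - 1)) =
      (2 * Real.pi) ^ (1 - 2 * H) * |x| ^ (-(2 * H - 1)) *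
        Real.sinc (Real.pi * x) ^ (-(2 * H - 1)) := by
    rw [hsin, show 2 * (Real.pi * x * Real.sinc (Real.pi * x)) =
      2 * Real.pi * (x * Real.sinc (Real.pi * x)) by ring, abs_mul (2 * Real.pi), abs_mul x, abs_of_pos hpi,
      abs_of_pos hS, Real.mul_rpow hpi.le (by positivity), Real.mul_rpow hax.le hS.le, mul_assoc]
    congr 2
    ring
  have e2 : (2 * Real.pi) ^ (2 * H + 1) * (2 * Real.pi) ^ (-(2 * H + 1)) = 1 := by
    rw [← Real.rpow_add hpi, add_neg_cancel, Real.rpow_zero]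
  -- In the j = 0 term, sin² lowers the singularity from order 2H + 1 to 2H - 1, the order in f_H.
  have e3 : Real.sin (Real.pi * x) ^ 2 * |x| ^ (-(2 * H + 1)) =
      Real.pi ^ 2 * Real.sinc (Real.pi * x) ^ 2 * |x| ^ (-(2 * H - 1)) := by
    have : |x| ^ (-(2 * H - 1)) = x ^ 2 * |x| ^ (-(2 * H + 1)) := by
      rw [← sq_abs, ← Real.rpow_natCast, ← Real.rpow_add hax]
      congr 1; push_cast; ring
    rw [hsin, this]
    ring
  rw [fracDensity, e1, fgnDensity, tsum_int_abs_rpow (by linarith) hx, densityDiff, aliasedPart,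
    regularFactor]
  have e4 : ∀ A B c : ℝ, c * (Real.pi ^ 2)⁻¹ * (2 * Real.pi) ^ (2 * H + 1) *
      Real.sin (Real.pi * x) ^ 2 * ((2 * Real.pi) ^ (-(2 * H + 1)) *
        (|x| ^ (-(2 * H + 1)) + (A + B))) =
      c * Real.sinc (Real.pi * x) ^ 2 * |x| ^ (-(2 * H - 1)) +
        c * (Real.pi ^ 2)⁻¹ * Real.sin (Real.pi * x) ^ 2 * (A + B) := by
    intro A B c
    calc _ = c * (Real.pi ^ 2)⁻¹ * ((2 * Real.pi) ^ (2 * H + 1) * (2 * Real.pi) ^ (-(2 * H + 1))) *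
          (Real.sin (Real.pi * x) ^ 2 * |x| ^ (-(2 * H + 1)) +
            Real.sin (Real.pi * x) ^ 2 * (A + B)) := by ring
      _ = _ := by
        rw [e2, e3]
        field_simp
  -- Only here do the prefactors meet: with c = (2π)^{1-2H} h(0) the two singular terms combine into
  -- |x|^{-s} g.
  rw [e4, ← hnorm, fracPrefactor]
  ring

theorem regularFactor_zero (H : ℝ) (h : ℝ → ℝ) : regularFactor H h 0 = 0 := by
  simp [regularFactor]

theorem regularFactor_neg {H : ℝ} {h : ℝ → ℝ} {x : ℝ} (hx : h (-x) = h x) :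
    regularFactor H h (-x) = regularFactor H h x := by
  simp only [regularFactor, mul_neg, Real.sinc_neg, hx]

theorem contDiffOn_regularFactor {H : ℝ} {h : ℝ → ℝ} {S : Set ℝ}
    (hS : S ⊆ Icc (-1 / 2 : ℝ) (1 / 2)) (hh : ContDiffOn ℝ 2 h S) :
    ContDiffOn ℝ 2 (regularFactor H h) S := by
  have h1 : ContDiff ℝ 2 fun x : ℝ => Real.sinc (Real.pi * x) :=
    contDiff_sinc.comp (contDiff_const.mul contDiff_id)
  exact contDiffOn_const.mul ((hh.mul (h1.contDiffOn.rpow_const_of_ne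
    fun x hx => (sinc_pi_mul_pos (hS hx)).ne')).sub (contDiffOn_const.mul (h1.contDiffOn.pow 2)))

theorem aliasedPart_zero (H c : ℝ) : aliasedPart H c 0 = 0 := by
  simp [aliasedPart]

theorem aliasedPart_neg (H c x : ℝ) : aliasedPart H c (-x) = aliasedPart H c x := by
  simp only [aliasedPart, mul_neg, Real.sin_neg, neg_neg]
  ring

theorem contDiffOn_aliasedPart {H c : ℝ} (hH : 0 < H) {S : Set ℝ}
    (hS : S ⊆ Icc (-1 / 2 : ℝ) (1 / 2)) : ContDiffOn ℝ 2 (aliasedPart H c) S := by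
  intro x hx
  have hx' := hS hx
  have h1 : ContDiffAt ℝ 2 (shiftedSum (2 * H + 1)) x :=
    contDiffAt_shiftedSum (by linarith) (by linarith [hx'.1])
  have h2 : ContDiffAt ℝ 2 (fun y => shiftedSum (2 * H + 1) (-y)) x :=
    ContDiffAt.comp x (contDiffAt_shiftedSum (by linarith) (by linarith [hx'.2]))
      contDiff_neg.contDiffAt
  have h3 : ContDiff ℝ 2 fun x : ℝ => c * (Real.pi ^ 2)⁻¹ * Real.sin (Real.pi * x) ^ 2 := by
    fun_prop
  exact (h3.contDiffAt.mul (h1.add h2)).contDiffWithinAt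

theorem derivWithin_zero_of_even {r : ℝ} (hr : 0 < r) {g : ℝ → ℝ}
    (hg : DifferentiableOn ℝ g (Icc (-r) r)) (heven : ∀ x ∈ Icc (-r) r, g (-x) = g x) :
    derivWithin g (Icc (-r) r) 0 = 0 := by
  have hn : Icc (-r) r ∈ 𝓝 (0 : ℝ) := Icc_mem_nhds (by linarith) hr
  have h1 : HasDerivAt g (deriv g 0) 0 := (hg.differentiableAt hn).hasDerivAt
  have h2 : HasDerivAt (fun x => g (-x)) (-deriv g 0) 0 := by
    have h3 : HasDerivAt g (deriv g 0) (-0) := by rwa [neg_zero]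
    exact (h3.scomp (0 : ℝ) (hasDerivAt_neg (0 : ℝ))).congr_deriv (by simp)
  have h3 : HasDerivAt g (-deriv g 0) 0 :=
    h2.congr_of_eventuallyEq (by filter_upwards [hn] with x hx using (heven x hx).symm)
  rw [derivWithin_of_mem_nhds hn]
  linarith [h1.unique h3]

/-! ### Regularity of the difference -/

/-- Allowing r = 1/2 and using derivatives within the closed interval lets one statement cover both
the interior and the endpoint claims. -/
theorem densityDiff_regularity {H c r : ℝ} {h : ℝ → ℝ} (hH : 1 / 2 < H) (hH1 : H < 1)
    (hr : 0 < r) (hr1 : r ≤ 1 / 2) (heven : ∀ x ∈ Icc (-1 / 2 : ℝ) (1 / 2), h (-x) = h x)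
    (hh : ContDiffOn ℝ 2 h (Icc (-r) r)) :
    densityDiff H c h =O[𝓝 0] (fun x : ℝ => |x| ^ (3 - 2 * H)) ∧
    ∃ d : ℝ → ℝ,
      (∀ x ∈ Icc (-r) r, HasDerivWithinAt (densityDiff H c h) (d x) (Icc (-r) r) x) ∧
      ∀ α : ℝ≥0, (α : ℝ) < 2 - 2 * H → ∃ C : ℝ≥0, HolderOnWith C α d (Icc (-r) r) := by
  have hsub : Icc (-r) r ⊆ Icc (-1 / 2 : ℝ) (1 / 2) := Icc_subset_Icc (by linarith) hr1
  have h0 : (0 : ℝ) ∈ Icc (-r) r := ⟨by linarith, hr.le⟩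
  set s := 2 * H - 1 with hs
  have hs0 : 0 < s := by linarith
  have hs1 : s < 1 := by linarith
  have hg2 : ContDiffOn ℝ 2 (regularFactor H h) (Icc (-r) r) := contDiffOn_regularFactor hsub hh
  have hR2 : ContDiffOn ℝ 2 (aliasedPart H c) (Icc (-r) r) :=
    contDiffOn_aliasedPart (by linarith) hsub
  obtain ⟨hg, L, hL, hgL⟩ := exists_lipschitz_derivWithin hr hg2
  obtain ⟨hR, M, hM, hRM⟩ := exists_lipschitz_derivWithin hr hR2
  have hg'0 := derivWithin_zero_of_even hr (hg2.differentiableOn (by norm_num))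
    fun x hx => regularFactor_neg (H := H) (heven x (hsub hx))
  have hR'0 := derivWithin_zero_of_even hr (hR2.differentiableOn (by norm_num))
    fun x _ => aliasedPart_neg H c x
  have hgq := abs_le_mul_sq hr hg (regularFactor_zero H h) hg'0 hL hgL
  have hRq := abs_le_mul_sq hr hR (aliasedPart_zero H c) hR'0 hM hRM
  have hdiv := abs_div_sub_div_le hg (regularFactor_zero H h) hg'0 hL hgL
  -- L and M are Lipschitz constants of g' and R'. The bracket g' - s g/x is 2L-Lipschitz because s
  -- < 1, and the weight |x|^{-s} costs a factor 4.
  refine ⟨IsBigO.of_bound (L + M) ?_, fun x => |x| ^ (-s) * (derivWithin (regularFactor H h)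
      (Icc (-r) r) x - s * (regularFactor H h x / x)) - derivWithin (aliasedPart H c) (Icc (-r) r) x,
    fun x hx => (hasDerivWithinAt_abs_rpow_neg_mul hs1 hg (regularFactor_zero H h) hg'0 hgq x
      hx).sub (hR x hx), fun α hα => ⟨(4 * (2 * L) + M).toNNReal,
      holderOnWith_of_abs_sub_le (β := 1 - s) (by positivity) ?_ (by linarith) ?_⟩⟩
  · filter_upwards [Icc_mem_nhds (neg_lt_zero.2 hr) hr] with x hx
    have h1 := abs_rpow_neg_mul_le hs1 hgq x hx
    have h2 : |x| ^ 2 ≤ |x| ^ (2 - s) := by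
      rw [← Real.rpow_natCast]
      refine Real.rpow_le_rpow_of_exponent_ge' (abs_nonneg x)
        ((abs_le.2 hx).trans (by linarith)) (by linarith) (by push_cast; linarith)
    rw [Real.norm_eq_abs, Real.norm_eq_abs, abs_of_nonneg (Real.rpow_nonneg (abs_nonneg x) _),
      densityDiff, show 3 - 2 * H = 2 - s by ring, add_mul]
    exact (abs_sub _ _).trans (add_le_add h1 ((hRq x hx).trans (by gcongr)))
  · intro x hx y hy
    rw [abs_le]
    constructor <;> linarith [hx.1, hx.2, hy.1, hy.2]
  · intro x hx y hy
    have hxy1 : |x - y| ≤ 1 := by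
      rw [abs_le]
      constructor <;> linarith [hx.1, hx.2, hy.1, hy.2]
    have h1 := abs_rpow_neg_mul_sub_le (L := 2 * L) hs0 hs1 (by positivity)
      (m := fun x => derivWithin (regularFactor H h) (Icc (-r) r) x -
        s * (regularFactor H h x / x)) h0 (by simp [hg'0]) (fun x hx y hy => by
        rw [sub_sub_sub_comm, ← mul_sub]
        refine (abs_sub _ _).trans ?_
        rw [abs_mul, abs_of_pos hs0]
        have h2 := hgL x hx y hy
        have h3 := hdiv x hx y hy
        have h4 := mul_le_of_le_one_left (abs_nonneg
          (regularFactor H h x / x - regularFactor H h y / y)) hs1.le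
        linarith) x hx y hy
    have h2 : |x - y| ≤ |x - y| ^ (1 - s) := by
      simpa using Real.rpow_le_rpow_of_exponent_ge' (abs_nonneg (x - y)) hxy1
        (by linarith : 0 ≤ 1 - s) (by linarith : 1 - s ≤ 1)
    rw [sub_sub_sub_comm, add_mul]
    exact (abs_sub _ _).trans (add_le_add h1 ((hRM x hx y hy).trans (by gcongr)))

end FracNoise

theorem mainTheorem5 (H V : ℝ) (hH : 1 / 2 < H) (hH1 : H < 1) (hV : 0 < V)
    (h : ℝ → ℝ)
    (hpos : ∀ x ∈ Icc (-1 / 2 : ℝ) (1 / 2), 0 < h x)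
    (heven : ∀ x ∈ Icc (-1 / 2 : ℝ) (1 / 2), h (-x) = h x)
    (hcont : ContinuousOn h (Icc (-1 / 2 : ℝ) (1 / 2)))
    (hC3 : ContDiffOn ℝ 3 h (Ioo (-1 / 2 : ℝ) (1 / 2)))
    (hnorm : FracNoise.fracPrefactor H h = FracNoise.fgnPrefactor H V) :
    ∃ φ : ℝ → ℝ,
      (∀ x ∈ Icc (-1 / 2 : ℝ) (1 / 2), x ≠ 0 →
        FracNoise.fracDensity H h x = FracNoise.fgnDensity H V x + φ x) ∧
      φ 0 = 0 ∧
      φ =O[𝓝 0] (fun x : ℝ => |x| ^ (3 - 2 * H)) ∧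
      DifferentiableOn ℝ φ (Ioo (-1 / 2 : ℝ) (1 / 2)) ∧
      (∀ α : ℝ≥0, (α : ℝ) < 2 - 2 * H → ∀ r : ℝ, 0 < r → r < 1 / 2 →
        ∃ C : ℝ≥0, HolderOnWith C α (deriv φ) (Icc (-r) r)) ∧
      (ContDiffOn ℝ 3 h (Icc (-1 / 2 : ℝ) (1 / 2)) →
        DifferentiableOn ℝ φ (Icc (-1 / 2 : ℝ) (1 / 2)) ∧
        ∀ α : ℝ≥0, (α : ℝ) < 2 - 2 * H →
          ∃ C : ℝ≥0, HolderOnWith C α (derivWithin φ (Icc (-1 / 2 : ℝ) (1 / 2)))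
            (Icc (-1 / 2 : ℝ) (1 / 2))) := by
  have hloc : ∀ r : ℝ, r < 1 / 2 → ContDiffOn ℝ 2 h (Icc (-r) r) := fun r hr =>
    (hC3.of_le (by norm_num)).mono (Icc_subset_Ioo (by linarith) hr)
  have hreg := fun (r : ℝ) (h0 : 0 < r) (hr : r < 1 / 2) =>
    FracNoise.densityDiff_regularity (c := FracNoise.fgnPrefactor H V) hH hH1 h0 hr.le heven
      (hloc r hr)
  refine ⟨FracNoise.densityDiff H (FracNoise.fgnPrefactor H V) h,
    fun x hx hx0 => FracNoise.fracDensity_eq hH hnorm hx hx0, ?_,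
    (hreg (1 / 4) (by norm_num) (by norm_num)).1, ?_, ?_, ?_⟩
  · simp [FracNoise.densityDiff, FracNoise.regularFactor_zero, FracNoise.aliasedPart_zero]
  · intro x hx
    have hx2 : |x| < 1 / 2 := abs_lt.2 ⟨by linarith [hx.1], hx.2⟩
    obtain ⟨r, hxr, hr⟩ := exists_between hx2
    obtain ⟨-, d, hd, -⟩ := hreg r ((abs_nonneg x).trans_lt hxr) hr
    have hx' := abs_lt.1 hxr
    exact ((hd x ⟨hx'.1.le, hx'.2.le⟩).hasDerivAt
      (Icc_mem_nhds hx'.1 hx'.2)).differentiableAt.differentiableWithinAt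
  · intro α hα r hr0 hr
    -- On a slightly larger interval, every point of [-r, r] is interior, so the one-sided
    -- derivative d is the full derivative there.
    obtain ⟨r', hrr, hr'⟩ := exists_between hr
    obtain ⟨-, d, hd, hol⟩ := hreg r' (hr0.trans hrr) hr'
    obtain ⟨C, hC⟩ := hol α hα
    have hsub : Icc (-r) r ⊆ Icc (-r') r' := Icc_subset_Icc (by linarith) hrr.le
    have heq : ∀ x ∈ Icc (-r) r,
        deriv (FracNoise.densityDiff H (FracNoise.fgnPrefactor H V) h) x = d x := fun x hx =>
      ((hd x (hsub hx)).hasDerivAt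
        (Icc_mem_nhds (by linarith [hx.1]) (by linarith [hx.2]))).deriv
    refine ⟨C, fun x hx y hy => ?_⟩
    rw [heq x hx, heq y hy]
    exact hC x (hsub hx) y (hsub hy)
  · intro hcl
    rw [neg_div] at hcl ⊢
    obtain ⟨-, d, hd, hol⟩ := FracNoise.densityDiff_regularity (c := FracNoise.fgnPrefactor H V)
      hH hH1 (by norm_num) le_rfl heven (hcl.of_le (by norm_num))
    have heq : ∀ x ∈ Icc (-(1 / 2) : ℝ) (1 / 2), derivWithin
        (FracNoise.densityDiff H (FracNoise.fgnPrefactor H V) h) (Icc (-(1 / 2) : ℝ) (1 / 2)) x =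
          d x := fun x hx =>
      (hd x hx).derivWithin (uniqueDiffOn_Icc (by norm_num) x hx)
    refine ⟨fun x hx => (hd x hx).differentiableWithinAt, fun α hα => ?_⟩
    obtain ⟨C, hC⟩ := hol α hα
    refine ⟨C, fun x hx y hy => ?_⟩
    rw [heq x hx, heq y hy]
    exact hC x hx y hy
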